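/- Let $X$ and $Y$ be real Banach spaces, let $X',Y'$ be their continuous duals, let $S\colon X\to Y$ be a bounded linear operator, and let $F\subset X$ be convex. Errors take values in $[0,\infty]$, with the convention $0\cdot\infty=0$. **Restricted deterministic non-adaptive errors.** For $\Lambda\subset X'$ and $k\in\mathbb{N}_0$ let $$e_k^{\text{det-non}}(S,F,\Lambda):=\inf_{\substack{L_1,\dots,L_k\in\Lambda\\ \phi\colon\mathbb{R}^k\to Y}}\ \sup_{f\in F}\ \bigl\|S(f)-\phi(L_1(f),\dots,L_k(f))\bigr\|_Y,$$ where $\phi$ ranges over arbitrary maps. **Randomized errors.** A deterministic adaptive algorithm using $k$ pieces of linear information is a map $A=\phi\circ N_k\colon F\to Y$ with an arbitrary map $\phi\colon\mathbb{R}^k\to Y$ and $N_k$ given recursively by $N_j(f)=(N_{j-1}(f),L_j(f))$, where the functional $L_j\in X'$ may depend arbitrarily on $N_{j-1}(f)$. A randomized algorithm is a family $(A^\omega)_{\omega\in\Omega}$ of such algorithms indexed by a probability space $(\Omega,\mathcal A,\mathbb P)$ such that $(f,\omega)\mapsto\|S(f)-A^\omega(f)\|_Y$ is measurable with respect to $\mathcal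 B_F\otimes\mathcal A$, where $\mathcal B_F$ is the Borel $\sigma$-algebra on $F$ of the topology induced by the semi-norm with unit ball $F-F$ (its Minkowski functional). Let $$e_k^{\text{ran}}(S,F):=\inf_{(A^\omega)}\ \sup_{f\in F}\ \mathbb E\,\|S(f)-A^\omega(f)\|_Y .$$ **Theorem.** Let $\mathcal N\subset Y'$ be a norming set of $Y$, i.e. $\|y\|=\sup\{|\lambda(y)|:\lambda\in\mathcal N\}$ for all $y\in Y$ (in particular $\mathcal N\neq\emptyset$), and let $\Lambda\subset X'$ contain $\{\lambda\circ S:\lambda\in\mathcal N\}$. Then, for every integer $n\ge1$, $$e_{2n-1}^{\text{det-non}}(S,F,\Lambda)\ \le\ \Bigl(\prod_{k=0}^{2n-1}e_k^{\text{det-non}}(S,F,\Lambda)\Bigr)^{1/(2n)}\ \le\ 12\,n^{3/2}\,\Bigl(\prod_{k=0}^{n-1}e_k^{\text{ran}}(S,F)\Bigr)^{1/n}.$$ Moreover: (a) if $F$ is symmetric ($-F=F$), the factor $n^{3/2}$ can be replaced with $n$; (b) if $X$ is a Hilbert space and $F$ is its closed unit ball, then $$e_{4n-1}^{\text{det-non}}(S,F,\Lambda)\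 \le\ \Bigl(\prod_{k=0}^{4n-1}e_k^{\text{det-non}}(S,F,\Lambda)\Bigr)^{1/(4n)}\ \le\ 12\,n^{1/2}\,\Bigl(\prod_{k=0}^{n-1}e_k^{\text{ran}}(S,F)\Bigr)^{1/n}.$$ -/

import Mathlib

open scoped ENNReal Pointwise

universe u v w

section MinimalErrors

variable {X : Type u} {Y : Type v} [NormedAddCommGroup X] [NormedSpace ℝ X]
  [NormedAddCommGroup Y] [NormedSpace ℝ Y]

/-- A set `N` of continuous linear functionals is a norming set of `Y` if
`‖y‖ = sup {|l y| : l ∈ N}` for every `y`. -/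
def IsNormingSet (N : Set (Y →L[ℝ] ℝ)) : Prop :=
  ∀ y : Y, IsLUB ((fun l : Y →L[ℝ] ℝ => |l y|) '' N) ‖y‖

/-- Adaptive information: `N_0(f) = ()` and `N_{k+1}(f) = (N_k(f), L_{k+1}(f))`, where the
functional `L_{k+1} = L k (N_k(f))` may depend on the values measured before. -/
def adaptiveInfo (L : (k : ℕ) → (Fin k → ℝ) → (X →L[ℝ] ℝ)) (f : X) : (k : ℕ) → Fin k → ℝ
  | 0 => Fin.elim0
  | k + 1 => Fin.snoc (α := fun _ => ℝ) (adaptiveInfo L f k) (L k (adaptiveInfo L f k) f)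

/-- The class of deterministic adaptive algorithms on `F` using `n` continuous linear functionals:
all maps `φ ∘ N_n` with adaptive information `N_n` and an arbitrary reconstruction map `φ`. -/
def detAlgorithms (F : Set X) (Y : Type v) (n : ℕ) : Set (F → Y) :=
  {A | ∃ (L : (k : ℕ) → (Fin k → ℝ) → (X →L[ℝ] ℝ)) (φ : (Fin n → ℝ) → Y),
    ∀ f : F, A f = φ (adaptiveInfo L (f : X) n)}

/-- The topology on `F` generated by the open balls of the semi-norm whose unit ball
is `F - F` (its Minkowski functional `gauge (F - F)`). -/
@[reducible] def inputTopology (F : Set X) : TopologicalSpace F :=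
  TopologicalSpace.generateFrom
    {U | ∃ (g : F) (r : ℝ), U = {f : F | gauge (F - F) ((f : X) - (g : X)) < r}}

/-- The Borel sigma-algebra on `F` of the topology associated with `F`. -/
@[reducible] def inputMeasurableSpace (F : Set X) : MeasurableSpace F :=
  @borel F (inputTopology F)

/-- Randomized (adaptive) algorithms for approximating `S` over `F` with `n` pieces of linear
information: families of deterministic adaptive algorithms indexed by a probability space such that
`(f, ω) ↦ ‖S f - A ω f‖` is jointly measurable. -/
structure RandomizedAlgorithm (S : X →L[ℝ] Y) (F : Set X) (n : ℕ) where
  Ω : Type w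
  mΩ : MeasurableSpace Ω
  P : @MeasureTheory.Measure Ω mΩ
  isProb : MeasureTheory.IsProbabilityMeasure P
  A : Ω → F → Y
  mem : ∀ ω, A ω ∈ detAlgorithms F Y n
  meas : @Measurable (F × Ω) ℝ ((inputMeasurableSpace F).prod mΩ) (borel ℝ)
    (fun p => ‖S (p.1 : X) - A p.2 p.1‖)

/-- The worst-case error `sup_{f ∈ F} 𝔼 ‖S f - A f‖` of a randomized algorithm. -/
noncomputable def RandomizedAlgorithm.error {S : X →L[ℝ] Y} {F : Set X} {n : ℕ}
    (R : RandomizedAlgorithm.{u, v, w} S F n) : ℝ≥0∞ :=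
  ⨆ f : F, @MeasureTheory.lintegral R.Ω R.mΩ R.P (fun ω => ‖S (f : X) - R.A ω f‖ₑ)

/-- The `n`-th minimal worst-case error of randomized (adaptive) algorithms. -/
noncomputable def minErrRan (S : X →L[ℝ] Y) (F : Set X) (n : ℕ) : ℝ≥0∞ :=
  ⨅ R : RandomizedAlgorithm.{u, v, w} S F n, R.error

/-- The `n`-th minimal worst-case error of deterministic non-adaptive algorithms that only use
information from `Lam`. -/
noncomputable def minErrDetNon (S : X →L[ℝ] Y) (F : Set X) (Lam : Set (X →L[ℝ] ℝ)) (n : ℕ) :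
    ℝ≥0∞ :=
  ⨅ (L : Fin n → (X →L[ℝ] ℝ)) (_ : ∀ i, L i ∈ Lam) (φ : (Fin n → ℝ) → Y),
    ⨆ f : F, ‖S (f : X) - φ (fun i => L i (f : X))‖ₑ

end MinimalErrors

/-! The two kinds of error are compared through the determinant of a matrix `M i j = l i (S (u j))`,
where each `u j = f j - g j` is a difference of inputs. If `k` functionals `l i` from the norming
set are already chosen, an input difference invisible to all of them must be mapped by `S` to a
vector of norm close to or above the deterministic error with `k` measurements: otherwise, answering
with any input consistent with the data would do better. Choosing greedily gives a triangular `M` of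
size `2n` whose diagonal is as large as the deterministic errors, up to a limit. So their product is
bounded by `|det M|`, which is also the product of the singular values of `M`.

The singular values decrease, so `|det M|` is at most the product of the squares of those with index
`2k`, `k < n`. Each of these is bounded by a randomized error. On the span of the top `2k + 1`
singular directions `M` expands by at least its singular value of index `2k`. Entries of `M z` are
values of norming functionals, so `S` is bounded below there too, with loss `√(2n)`. If `F` contains
the image of a Euclidean ball of radius `r`, averaging over a thin shell of dimension `2k + 1` shows
that `k` adaptive measurements leave more than half of the mean squared norm undetermined. Hence the
randomized error is at least a constant times the singular value times `r / √(2n)`.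

Only `r` depends on the shape of `F`: of order `1/n` for convex sets, `1/√n` under symmetry, and `1`
for the Hilbert ball after orthonormalization. -/

/-! ### Adaptive maps as decision trees -/

section Adaptive

variable {E E' V V' : Type*} [AddCommGroup E] [Module ℝ E] [AddCommGroup E'] [Module ℝ E']

/-- Maps on a real vector space that depend on their argument only through `k` adaptively chosen
linear functionals. -/
def IsAdaptive : ℕ → (E → V) → Prop
  | 0, A => ∃ c, ∀ x, A x = c
  | k + 1, A => ∃ l : E →ₗ[ℝ] ℝ, ∀ y : ℝ, ∃ B : E → V, IsAdaptive k B ∧ ∀ x, l x = y → A x = B x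

theorem IsAdaptive.comp_affine {k : ℕ} {A : E → V} (hA : IsAdaptive k A) (T : E' →ₗ[ℝ] E) (c : E) :
    IsAdaptive k (fun x => A (T x + c)) := by
  induction k generalizing A with
  | zero =>
    obtain ⟨d, hd⟩ := hA
    exact ⟨d, fun x => hd _⟩
  | succ k ih =>
    obtain ⟨l, hl⟩ := hA
    refine ⟨l.comp T, fun y => ?_⟩
    obtain ⟨B, hB, hAB⟩ := hl (y + l c)
    refine ⟨_, ih hB, fun x hx => hAB _ ?_⟩
    rw [map_add, ← hx, LinearMap.comp_apply]

theorem IsAdaptive.map {k : ℕ} {A : E → V} (hA : IsAdaptive k A) (g : V → V') :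
    IsAdaptive k (fun x => g (A x)) := by
  induction k generalizing A with
  | zero =>
    obtain ⟨d, hd⟩ := hA
    exact ⟨g d, fun x => congrArg g (hd x)⟩
  | succ k ih =>
    obtain ⟨l, hl⟩ := hA
    refine ⟨l, fun y => ?_⟩
    obtain ⟨B, hB, hAB⟩ := hl y
    exact ⟨_, ih hB, fun x hx => congrArg g (hAB x hx)⟩

end Adaptive

section AdaptiveInfo

variable {X : Type u} [NormedAddCommGroup X] [NormedSpace ℝ X]

/-- Information is recorded by appending at the end, while `IsAdaptive` peels off the first
measurement; this passes from one to the other. -/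
theorem adaptiveInfo_succ_eq_cons (L : (k : ℕ) → (Fin k → ℝ) → (X →L[ℝ] ℝ)) (f : X) (y : ℝ)
    (hy : L 0 Fin.elim0 f = y) (k : ℕ) :
    adaptiveInfo L f (k + 1) = Fin.cons (α := fun _ => ℝ) y
      (adaptiveInfo (fun j v => L (j + 1) (Fin.cons (α := fun _ => ℝ) y v)) f k) := by
  induction k with
  | zero =>
    ext i
    fin_cases i
    simpa [adaptiveInfo, Fin.snoc] using hy
  | succ k ih =>
    rw [adaptiveInfo, ih, adaptiveInfo, Fin.cons_snoc_eq_snoc_cons]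

theorem isAdaptive_adaptiveInfo {V : Type*} (n : ℕ) (L : (k : ℕ) → (Fin k → ℝ) → (X →L[ℝ] ℝ))
    (φ : (Fin n → ℝ) → V) : IsAdaptive n (fun f => φ (adaptiveInfo L f n)) := by
  induction n generalizing L with
  | zero => exact ⟨φ Fin.elim0, fun x => rfl⟩
  | succ n ih =>
    refine ⟨(L 0 Fin.elim0 : X →ₗ[ℝ] ℝ), fun y => ?_⟩
    refine ⟨_, ih (fun j v => L (j + 1) (Fin.cons (α := fun _ => ℝ) y v))
      (fun v => φ (Fin.cons (α := fun _ => ℝ) y v)), fun f hf => ?_⟩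
    simp only [adaptiveInfo_succ_eq_cons L f y hf]

end AdaptiveInfo

/-! ### Radial averages of the error of an adaptive map -/

section Averaging

open MeasureTheory

theorem lintegral_fin_succ {n : ℕ} (f : (Fin (n + 1) → ℝ) → ℝ≥0∞) (hf : Measurable f) :
    ∫⁻ x, f x = ∫⁻ y : ℝ, ∫⁻ x : Fin n → ℝ, f (Fin.cons (α := fun _ => ℝ) y x) := by
  have h := (volume_preserving_piFinSuccAbove (fun _ : Fin (n + 1) => ℝ) 0).symm
  rw [← h.lintegral_comp hf, Measure.volume_eq_prod, lintegral_prod]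
  · simp [MeasurableEquiv.piFinSuccAbove, Fin.insertNthEquiv]
  · exact (hf.comp (MeasurableEquiv.measurable _)).aemeasurable

/-- The reflection exchanging `z` with the vector of equal length on the first axis does this. -/
theorem EuclideanSpace.exists_isometry_inner_eq {n : ℕ} (z : EuclideanSpace ℝ (Fin (n + 1))) :
    ∃ ρ : EuclideanSpace ℝ (Fin (n + 1)) ≃ₗᵢ[ℝ] EuclideanSpace ℝ (Fin (n + 1)),
      ∀ x, inner ℝ z (ρ x) = ‖z‖ * x 0 := by
  have hn : ‖‖z‖ • EuclideanSpace.single (0 : Fin (n + 1)) (1 : ℝ)‖ = ‖z‖ := by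
    simp [norm_smul]
  refine ⟨(Submodule.span ℝ
    {‖z‖ • EuclideanSpace.single (0 : Fin (n + 1)) (1 : ℝ) - z})ᗮ.reflection, fun x => ?_⟩
  have hρ := Submodule.reflection_sub hn
  calc _ = inner ℝ ((Submodule.span ℝ
        {‖z‖ • EuclideanSpace.single (0 : Fin (n + 1)) (1 : ℝ) - z})ᗮ.reflection
        (‖z‖ • EuclideanSpace.single (0 : Fin (n + 1)) (1 : ℝ))) _ := by rw [hρ]
    _ = _ := by
      rw [LinearIsometryEquiv.inner_map_map, inner_smul_left, EuclideanSpace.inner_single_left]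
      simp

/-- Every linear functional on `ℝⁿ⁺¹` is, after an isometry preserving Lebesgue measure, a multiple of
the first coordinate. -/
theorem exists_rotation {n : ℕ} (l : (Fin (n + 1) → ℝ) →ₗ[ℝ] ℝ) :
    ∃ (R : (Fin (n + 1) → ℝ) →ₗ[ℝ] (Fin (n + 1) → ℝ)) (a : ℝ), MeasurePreserving R ∧
      (∀ x, ∑ i, R x i ^ 2 = ∑ i, x i ^ 2) ∧ ∀ x, l (R x) = a * x 0 := by
  let E := EuclideanSpace ℝ (Fin (n + 1))
  let e : E ≃ₗ[ℝ] (Fin (n + 1) → ℝ) := WithLp.linearEquiv 2 ℝ _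
  let l' : E →L[ℝ] ℝ := LinearMap.toContinuousLinearMap (l.comp e.toLinearMap)
  let z : E := (InnerProductSpace.toDual ℝ E).symm l'
  have hz : ∀ x : E, inner ℝ z x = l (e x) := fun x => by
    simp [z, l']
  obtain ⟨ρ, hρ⟩ := EuclideanSpace.exists_isometry_inner_eq z
  refine ⟨e.toLinearMap.comp (ρ.toLinearEquiv.toLinearMap.comp e.symm.toLinearMap), ‖z‖, ?_, ?_, ?_⟩
  · exact (PiLp.volume_preserving_ofLp _).comp
      (ρ.measurePreserving.comp (PiLp.volume_preserving_toLp _))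
  · intro x
    have h := ρ.norm_map (e.symm x)
    have h2 : ‖ρ (e.symm x)‖ ^ 2 = ‖e.symm x‖ ^ 2 := by rw [h]
    rw [EuclideanSpace.real_norm_sq_eq, EuclideanSpace.real_norm_sq_eq] at h2
    exact h2
  · intro x
    exact (hz _).symm.trans (hρ _)

/-- Prepending a zero coordinate. -/
def consZero (n : ℕ) : (Fin n → ℝ) →ₗ[ℝ] (Fin (n + 1) → ℝ) where
  toFun x := Fin.cons (α := fun _ => ℝ) 0 x
  map_add' x x' := by ext i; refine Fin.cases ?_ (fun j => ?_) i <;> simp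
  map_smul' c x := by ext i; refine Fin.cases ?_ (fun j => ?_) i <;> simp

theorem consZero_apply {n : ℕ} (x : Fin n → ℝ) :
    consZero n x = Fin.cons (α := fun _ => ℝ) 0 x := rfl

theorem cons_eq_consZero_add {n : ℕ} (y : ℝ) (x : Fin n → ℝ) :
    Fin.cons (α := fun _ => ℝ) y x = consZero n x + Fin.cons (α := fun _ => ℝ) y 0 := by
  ext i; refine Fin.cases ?_ (fun j => ?_) i <;> simp [consZero_apply]

theorem measurable_finCons {n : ℕ} (y : ℝ) :
    Measurable (fun x : Fin n → ℝ => (Fin.cons (α := fun _ => ℝ) y x : Fin (n + 1) → ℝ)) := by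
  refine measurable_pi_iff.2 fun i => ?_
  refine Fin.cases ?_ (fun j => ?_) i
  · simp
  · simpa using measurable_pi_apply j

theorem sum_sq_cons {n : ℕ} (y : ℝ) (x : Fin n → ℝ) :
    ∑ i, (Fin.cons (α := fun _ => ℝ) y x : Fin (n + 1) → ℝ) i ^ 2 = y ^ 2 + ∑ i, x i ^ 2 := by
  simp [Fin.sum_univ_succ]

variable {V : Type*} [NormedAddCommGroup V] [NormedSpace ℝ V]

/-- Averaged over a radial weight, an algorithm using `k` adaptive linear measurements has at least the
error caused by the `n - k` coordinates left after `k` measurements. The proof slices along the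
measured functionals, so that no measurability of the information map is needed. -/
theorem lintegral_le_of_adaptive (k : ℕ) {n : ℕ} (T : (Fin n → ℝ) →ₗ[ℝ] V) {σ : ℝ}
    (hT : ∀ x, σ * √(∑ i, x i ^ 2) ≤ ‖T x‖) {A : (Fin n → ℝ) → V} (hA : IsAdaptive k A)
    {w : ℝ → ℝ≥0∞} (hw : Measurable w) {H : (Fin n → ℝ) → ℝ≥0∞} (hH : Measurable H)
    (hTA : ∀ x, w (∑ i, x i ^ 2) * ‖T x - A x‖ₑ ≤ H x) :
    ∫⁻ x : Fin n → ℝ, w (∑ i, x i ^ 2) *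
      ENNReal.ofReal (σ * √(∑ i : Fin n, if k ≤ (i : ℕ) then x i ^ 2 else 0)) ≤ ∫⁻ x, H x := by
  induction k generalizing n w with
  | zero =>
    obtain ⟨c, hc⟩ := hA
    -- With a constant output, the errors at `x` and `-x` add up to at least `‖2 T x‖`, and the
    -- weight is even.
    have h1 : ∀ x : Fin n → ℝ, 2 * (w (∑ i, x i ^ 2) * ENNReal.ofReal (σ * √(∑ i, x i ^ 2)))
        ≤ H x + H (-x) := by
      intro x
      have h2 := add_le_add (hTA x) (hTA (-x))
      simp only [Pi.neg_apply, neg_sq] at h2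
      refine le_trans ?_ h2
      rw [hc, hc, ← mul_add, mul_left_comm]
      gcongr
      have h3 : ENNReal.ofReal (σ * √(∑ i, x i ^ 2)) ≤ ‖T x‖ₑ := by
        rw [← ofReal_norm]
        exact ENNReal.ofReal_le_ofReal (hT x)
      calc 2 * ENNReal.ofReal (σ * √(∑ i, x i ^ 2)) ≤ 2 * ‖T x‖ₑ := by gcongr
        _ = ‖(2 : ℝ) • T x‖ₑ := by
          rw [enorm_smul]; congr 1
          rw [Real.enorm_eq_ofReal (by norm_num)]; simp
        _ = ‖(T x - c) - (T (-x) - c)‖ₑ := by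
          congr 1; rw [map_neg, two_smul]; abel
        _ ≤ _ := enorm_sub_le
    have h2 : 2 * ∫⁻ x : Fin n → ℝ, w (∑ i, x i ^ 2) * ENNReal.ofReal (σ * √(∑ i, x i ^ 2)) ≤
        2 * ∫⁻ x, H x := by
      rw [← lintegral_const_mul' _ _ (by norm_num)]
      refine (lintegral_mono h1).trans ?_
      rw [lintegral_add_left hH, lintegral_neg_eq_self (f := H), two_mul]
    simpa using (ENNReal.mul_le_mul_iff_right (by norm_num) (by norm_num)).1 h2
  | succ k ih =>
    cases n with
    | zero => simp
    | succ n =>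
      obtain ⟨l, hl⟩ := hA
      obtain ⟨R, a, hR, hRsq, hRl⟩ := exists_rotation l
      rw [← hR.lintegral_comp hH, lintegral_fin_succ, lintegral_fin_succ]
      · refine lintegral_mono fun y => ?_
        -- After rotation the first measurement is constant on the slice with first coordinate `y`,
        -- so only `k` measurements act there. The slice is affine; its offset is moved into the
        -- output, and `y ^ 2` into the weight.
        obtain ⟨B, hB, hAB⟩ := hl (a * y)
        have hB' : IsAdaptive k (fun x => B (R (consZero n x) + R (Fin.cons (α := fun _ => ℝ) y 0)) -
            T (R (Fin.cons (α := fun _ => ℝ) y 0))) :=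
          (hB.comp_affine (R.comp (consZero n)) (R (Fin.cons (α := fun _ => ℝ) y 0))).map
            (fun v => v - T (R (Fin.cons (α := fun _ => ℝ) y 0)))
        have key := ih (T.comp (R.comp (consZero n))) (fun x => ?_) hB'
          (w := fun s => w (y ^ 2 + s)) (hw.comp (measurable_const_add _))
          (H := fun x => H (R (Fin.cons (α := fun _ => ℝ) y x)))
          (hH.comp (hR.measurable.comp (measurable_finCons y))) ?_
        · refine le_trans (le_of_eq ?_) key
          refine lintegral_congr fun x => ?_
          rw [sum_sq_cons, Fin.sum_univ_succ]
          simp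
        · have := hT (R (consZero n x))
          rw [hRsq, consZero_apply, sum_sq_cons] at this
          simpa [consZero_apply] using this
        · intro x
          have h1 := hTA (R (Fin.cons (α := fun _ => ℝ) y x))
          rw [hRsq, hAB _ (by rw [hRl]; simp), sum_sq_cons] at h1
          refine le_trans (le_of_eq ?_) h1
          rw [cons_eq_consZero_add y x, map_add, map_add]
          congr 2
          simp only [LinearMap.comp_apply]
          abel
      · exact hH.comp hR.measurable
      · refine Measurable.mul (hw.comp (by fun_prop)) ?_
        refine ENNReal.measurable_ofReal.comp (measurable_const.mul
          (Real.continuous_sqrt.measurable.comp ?_))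
        refine Finset.measurable_sum _ fun i _ => ?_
        split_ifs
        · fun_prop
        · exact measurable_const

end Averaging

/-! ### Second moments on a thin spherical shell -/

section Shell

open MeasureTheory

/-- The indicator function of the interval `[24/25, 1]`, used as a radial weight. -/
noncomputable def shellWeight : ℝ → ℝ≥0∞ := (Set.Icc (24 / 25) 1).indicator 1

theorem measurable_shellWeight : Measurable shellWeight :=
  measurable_one.indicator measurableSet_Icc

theorem shellWeight_of_mem {s : ℝ} (hs : s ∈ Set.Icc (24 / 25 : ℝ) 1) : shellWeight s = 1 :=
  Set.indicator_of_mem hs _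

theorem shellWeight_of_notMem {s : ℝ} (hs : s ∉ Set.Icc (24 / 25 : ℝ) 1) : shellWeight s = 0 :=
  Set.indicator_of_notMem hs _

theorem shellWeight_le_one (s : ℝ) : shellWeight s ≤ 1 := by
  by_cases hs : s ∈ Set.Icc (24 / 25 : ℝ) 1
  · rw [shellWeight_of_mem hs]
  · rw [shellWeight_of_notMem hs]; exact zero_le_one

/-- The volume of the spherical shell `24/25 ≤ |x|² ≤ 1`. -/
noncomputable def shellVolume (n : ℕ) : ℝ≥0∞ := ∫⁻ x : Fin n → ℝ, shellWeight (∑ i, x i ^ 2)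

theorem shellVolume_ne_top (n : ℕ) : shellVolume n ≠ ∞ := by
  have h : ∀ x : Fin n → ℝ, shellWeight (∑ i, x i ^ 2) ≤
      (Metric.closedBall (0 : Fin n → ℝ) 1).indicator 1 x := by
    intro x
    by_cases hx : ∑ i, x i ^ 2 ∈ Set.Icc (24 / 25 : ℝ) 1
    · rw [Set.indicator_of_mem]
      · exact shellWeight_le_one _
      · rw [mem_closedBall_zero_iff, pi_norm_le_iff_of_nonneg zero_le_one]
        intro i
        have h1 : x i ^ 2 ≤ 1 :=
          (Finset.single_le_sum (fun j _ => sq_nonneg (x j)) (Finset.mem_univ i)).trans hx.2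
        rw [Real.norm_eq_abs]
        exact (sq_le_one_iff_abs_le_one _).1 h1
    · rw [shellWeight_of_notMem hx]; exact zero_le
  refine ne_top_of_le_ne_top ?_ (lintegral_mono h)
  rw [lintegral_indicator_one measurableSet_closedBall]
  exact measure_closedBall_lt_top.ne

theorem shellVolume_ne_zero (n : ℕ) : shellVolume (n + 1) ≠ 0 := by
  have hc : Continuous (fun x : Fin (n + 1) → ℝ => ∑ i, x i ^ 2) := by fun_prop
  have ho : IsOpen ((fun x : Fin (n + 1) → ℝ => ∑ i, x i ^ 2) ⁻¹' Set.Ioo (24 / 25) 1) :=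
    isOpen_Ioo.preimage hc
  have hne : ((fun x : Fin (n + 1) → ℝ => ∑ i, x i ^ 2) ⁻¹' Set.Ioo (24 / 25) 1).Nonempty := by
    refine ⟨Fin.cons (α := fun _ => ℝ) (99 / 100) 0, ?_⟩
    rw [Set.mem_preimage, sum_sq_cons]
    norm_num
  refine ((ho.measure_pos volume hne).trans_le ?_).ne'
  rw [← lintegral_indicator_one ho.measurableSet]
  refine lintegral_mono fun x => ?_
  by_cases hx : x ∈ (fun x : Fin (n + 1) → ℝ => ∑ i, x i ^ 2) ⁻¹' Set.Ioo (24 / 25) 1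
  · rw [Set.indicator_of_mem hx, shellWeight_of_mem (Set.Ioo_subset_Icc_self hx)]
    rfl
  · rw [Set.indicator_of_notMem hx]
    exact bot_le

theorem lintegral_shellWeight_mul_sq_eq {n : ℕ} (i j : Fin n) :
    ∫⁻ x : Fin n → ℝ, shellWeight (∑ l, x l ^ 2) * ENNReal.ofReal (x i ^ 2) =
      ∫⁻ x : Fin n → ℝ, shellWeight (∑ l, x l ^ 2) * ENNReal.ofReal (x j ^ 2) := by
  have h := volume_measurePreserving_piCongrLeft (fun _ : Fin n => ℝ) (Equiv.swap i j)
  rw [← h.lintegral_comp_emb (MeasurableEquiv.measurableEmbedding _)]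
  refine lintegral_congr fun x => ?_
  have hx : ∀ l, MeasurableEquiv.piCongrLeft (fun _ : Fin n => ℝ) (Equiv.swap i j) x l =
      x (Equiv.swap i j l) := fun l => by
    have := MeasurableEquiv.piCongrLeft_apply_apply (β := fun _ : Fin n => ℝ) (Equiv.swap i j) x
      (Equiv.swap i j l)
    rwa [Equiv.swap_apply_self] at this
  simp only [hx]
  rw [Equiv.swap_apply_left, Equiv.sum_comp (Equiv.swap i j) (fun l => x l ^ 2)]

/-- By symmetry all coordinates have the same second moment. The `k + 1` remaining ones out of `2k +
1` carry more than half of a total that is at least `24/25`, and `t ≤ √t` on `[0, 1]` passes from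
squares to the norm. -/
theorem shellVolume_mul_le (k : ℕ) {σ : ℝ} (hσ : 0 ≤ σ) :
    ENNReal.ofReal (12 / 25 * σ) * shellVolume (2 * k + 1) ≤
      ∫⁻ x : Fin (2 * k + 1) → ℝ, shellWeight (∑ i, x i ^ 2) *
        ENNReal.ofReal (σ * √(∑ i : Fin (2 * k + 1), if k ≤ (i : ℕ) then x i ^ 2 else 0)) := by
  set J : ℝ≥0∞ := ∫⁻ x : Fin (2 * k + 1) → ℝ,
    shellWeight (∑ l, x l ^ 2) * ENNReal.ofReal (x 0 ^ 2) with hJ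
  have hm : ∀ i : Fin (2 * k + 1), Measurable fun x : Fin (2 * k + 1) → ℝ =>
      shellWeight (∑ l, x l ^ 2) * ENNReal.ofReal (x i ^ 2) := fun i =>
    (measurable_shellWeight.comp (by fun_prop)).mul (by fun_prop)
  have hsum : ∀ s : Finset (Fin (2 * k + 1)), ∫⁻ x : Fin (2 * k + 1) → ℝ,
      shellWeight (∑ l, x l ^ 2) * ENNReal.ofReal (∑ i ∈ s, x i ^ 2) = s.card * J := by
    intro s
    simp_rw [ENNReal.ofReal_sum_of_nonneg (fun i _ => sq_nonneg _), Finset.mul_sum]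
    rw [lintegral_finsetSum _ (fun i _ => hm i),
      Finset.sum_congr rfl (fun i _ => lintegral_shellWeight_mul_sq_eq i 0), Finset.sum_const,
      nsmul_eq_mul]
  have hcard : (Finset.univ.filter fun i : Fin (2 * k + 1) => k ≤ (i : ℕ)).card = k + 1 := by
    have h := Fin.card_Ici (⟨k, by omega⟩ : Fin (2 * k + 1))
    rw [show (2 * k + 1 - (⟨k, by omega⟩ : Fin (2 * k + 1)).val) = k + 1 by simp; omega] at h
    rw [← h]
    congr 1
    ext i
    simp [Fin.le_def]
  have h1 : ENNReal.ofReal (24 / 25) * shellVolume (2 * k + 1) ≤ (2 * k + 1 : ℕ) * J := by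
    have := hsum Finset.univ
    rw [Finset.card_univ, Fintype.card_fin] at this
    rw [← this, shellVolume, ← lintegral_const_mul' _ _ ENNReal.ofReal_ne_top]
    refine lintegral_mono fun x => ?_
    by_cases hx : ∑ i, x i ^ 2 ∈ Set.Icc (24 / 25 : ℝ) 1
    · simp only [shellWeight_of_mem hx, one_mul, mul_one]
      exact ENNReal.ofReal_le_ofReal hx.1
    · simp [shellWeight_of_notMem hx]
  have h2 : ENNReal.ofReal (12 / 25) * shellVolume (2 * k + 1) ≤ (k + 1 : ℕ) * J := by
    refine (ENNReal.mul_le_mul_iff_right (a := 2) (by norm_num) (by norm_num)).1 ?_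
    calc 2 * (ENNReal.ofReal (12 / 25) * shellVolume (2 * k + 1))
        = ENNReal.ofReal (24 / 25) * shellVolume (2 * k + 1) := by
          rw [← mul_assoc]; congr 1
          rw [← ENNReal.ofReal_ofNat, ← ENNReal.ofReal_mul (by norm_num)]; norm_num
      _ ≤ (2 * k + 1 : ℕ) * J := h1
      _ ≤ (2 * (k + 1) : ℕ) * J := by gcongr; omega
      _ = 2 * ((k + 1 : ℕ) * J) := by push_cast; ring
  calc ENNReal.ofReal (12 / 25 * σ) * shellVolume (2 * k + 1)
      = ENNReal.ofReal σ * (ENNReal.ofReal (12 / 25) * shellVolume (2 * k + 1)) := by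
        rw [← mul_assoc, ← ENNReal.ofReal_mul hσ, mul_comm σ]
    _ ≤ ENNReal.ofReal σ * ((k + 1 : ℕ) * J) := by gcongr
    _ = ∫⁻ x : Fin (2 * k + 1) → ℝ, ENNReal.ofReal σ * (shellWeight (∑ i, x i ^ 2) *
        ENNReal.ofReal (∑ i : Fin (2 * k + 1), if k ≤ (i : ℕ) then x i ^ 2 else 0)) := by
      rw [lintegral_const_mul' _ _ ENNReal.ofReal_ne_top, ← hcard, ← hsum]
      simp_rw [Finset.sum_filter]
    _ ≤ _ := by
      refine lintegral_mono fun x => ?_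
      by_cases hx : ∑ i, x i ^ 2 ∈ Set.Icc (24 / 25 : ℝ) 1
      · simp only [shellWeight_of_mem hx, one_mul]
        rw [← ENNReal.ofReal_mul hσ]
        refine ENNReal.ofReal_le_ofReal (mul_le_mul_of_nonneg_left ?_ hσ)
        have h0 : 0 ≤ ∑ i : Fin (2 * k + 1), if k ≤ (i : ℕ) then x i ^ 2 else 0 :=
          Finset.sum_nonneg fun i _ => by split_ifs <;> positivity
        have h1 : (∑ i : Fin (2 * k + 1), if k ≤ (i : ℕ) then x i ^ 2 else 0) ≤ 1 := by
          refine le_trans (Finset.sum_le_sum fun i _ => ?_) hx.2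
          split_ifs
          · exact le_rfl
          · positivity
        refine Real.le_sqrt_of_sq_le ?_
        nlinarith
      · simp [shellWeight_of_notMem hx]

end Shell

/-! ### Lower bound for randomized algorithms -/

section RandomizedLowerBound

open MeasureTheory

variable {X : Type u} {Y : Type v} [NormedAddCommGroup X] [NormedSpace ℝ X]
  [NormedAddCommGroup Y] [NormedSpace ℝ Y]

theorem continuous_inputTopology {Z : Type*} [TopologicalSpace Z] {F : Set X} (hF : Convex ℝ F)
    (f : Z → F) (hf : ∀ z, ∀ ε : ℝ, 0 < ε → ∀ᶠ z' in nhds z, ((f z' : X) - f z) ∈ ε • (F - F)) :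
    @Continuous Z F _ (inputTopology F) f := by
  refine continuous_generateFrom_iff.2 ?_
  rintro _ ⟨g, r, rfl⟩
  rw [isOpen_iff_mem_nhds]
  intro z hz
  have hFF : Convex ℝ (F - F) := hF.sub hF
  have hz' : gauge (F - F) ((f z : X) - g) < r := hz
  rw [gauge_def] at hz'
  -- `F - F` need not be absorbing, and `gauge` is `0` where no multiple of the set contains the
  -- point. Differences of inputs are safe, since `t = 1` is admissible.
  have hne : ({t ∈ Set.Ioi (0 : ℝ) | (f z : X) - g ∈ t • (F - F)}).Nonempty :=
    ⟨1, Set.mem_Ioi.2 one_pos, by rw [one_smul]; exact Set.sub_mem_sub (f z).2 g.2⟩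
  obtain ⟨t, ⟨ht0, ht⟩, htr⟩ := exists_lt_of_csInf_lt hne hz'
  filter_upwards [hf z ((r - t) / 2) (by linarith)] with z' h
  have hmem : (f z' : X) - g ∈ ((r - t) / 2 + t) • (F - F) := by
    rw [hFF.add_smul (by linarith) (le_of_lt ht0)]
    exact ⟨_, h, _, ht, sub_add_sub_cancel _ _ _⟩
  refine (gauge_le_of_mem (by linarith [Set.mem_Ioi.1 ht0]) hmem).trans_lt ?_
  linarith

theorem shellVolume_mul_le_of_adaptive (S : X →L[ℝ] Y) (k : ℕ) {σ : ℝ} (hσ : 0 ≤ σ)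
    (c : X) (T : (Fin (2 * k + 1) → ℝ) →ₗ[ℝ] X) (hT : ∀ x, σ * √(∑ i, x i ^ 2) ≤ ‖S (T x)‖)
    {A : X → Y} (hA : IsAdaptive k A) {H : (Fin (2 * k + 1) → ℝ) → ℝ≥0∞} (hH : Measurable H)
    (hAH : ∀ x, shellWeight (∑ i, x i ^ 2) * ‖S (T x + c) - A (T x + c)‖ₑ ≤ H x) :
    ENNReal.ofReal (12 / 25 * σ) * shellVolume (2 * k + 1) ≤ ∫⁻ x, H x := by
  refine (shellVolume_mul_le k hσ).trans (lintegral_le_of_adaptive k (S.toLinearMap.comp T) hT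
    ((hA.comp_affine T c).map (fun y => y - S c)) measurable_shellWeight hH fun x => ?_)
  refine le_trans (le_of_eq ?_) (hAH x)
  rw [map_add]
  congr 2
  simp only [LinearMap.comp_apply, ContinuousLinearMap.coe_coe]
  abel

/-- The worst case dominates the shell average. Tonelli moves the average inside the expectation,
where the deterministic bound applies for each fixed `ω`. -/
theorem le_error_of_measurable (S : X →L[ℝ] Y) {F : Set X} (k : ℕ) {σ : ℝ} (hσ : 0 ≤ σ)
    (c : X) (T : (Fin (2 * k + 1) → ℝ) →ₗ[ℝ] X) (hT : ∀ x, σ * √(∑ i, x i ^ 2) ≤ ‖S (T x)‖)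
    (f : (Fin (2 * k + 1) → ℝ) → F) (hfm : @Measurable _ F _ (inputMeasurableSpace F) f)
    (hfT : ∀ x, ∑ i, x i ^ 2 ≤ 1 → (f x : X) = T x + c) (R : RandomizedAlgorithm.{u, v, w} S F k) :
    ENNReal.ofReal (12 / 25 * σ) ≤ R.error := by
  let mΩ : MeasurableSpace R.Ω := R.mΩ
  have hP : IsProbabilityMeasure R.P := R.isProb
  have hGm : Measurable fun p : (Fin (2 * k + 1) → ℝ) × R.Ω => ‖S (f p.1 : X) - R.A p.2 (f p.1)‖ := by
    let : MeasurableSpace F := inputMeasurableSpace F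
    have h1 := R.meas
    rw [← BorelSpace.measurable_eq (α := ℝ)] at h1
    exact h1.comp ((hfm.comp measurable_fst).prodMk measurable_snd)
  have hGe : Measurable fun p : (Fin (2 * k + 1) → ℝ) × R.Ω =>
      shellWeight (∑ i, p.1 i ^ 2) * ‖S (f p.1 : X) - R.A p.2 (f p.1)‖ₑ := by
    refine (measurable_shellWeight.comp (by fun_prop)).mul ?_
    simp_rw [← ofReal_norm]
    exact ENNReal.measurable_ofReal.comp hGm
  have hlow : ∀ ω, ENNReal.ofReal (12 / 25 * σ) * shellVolume (2 * k + 1) ≤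
      ∫⁻ x : Fin (2 * k + 1) → ℝ,
        shellWeight (∑ i, x i ^ 2) * ‖S (f x : X) - R.A ω (f x)‖ₑ := by
    intro ω
    obtain ⟨L, φ, hLφ⟩ := R.mem ω
    have hm : Measurable fun x : Fin (2 * k + 1) → ℝ =>
        shellWeight (∑ i, x i ^ 2) * ‖S (f x : X) - R.A ω (f x)‖ₑ :=
      Measurable.of_uncurry_right (f := fun (x : Fin (2 * k + 1) → ℝ) ω =>
        shellWeight (∑ i, x i ^ 2) * ‖S (f x : X) - R.A ω (f x)‖ₑ) hGe
    refine shellVolume_mul_le_of_adaptive S k hσ c T hT (isAdaptive_adaptiveInfo k L φ) hm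
      fun x => ?_
    by_cases hx : ∑ i, x i ^ 2 ∈ Set.Icc (24 / 25 : ℝ) 1
    · rw [hLφ (f x), hfT x hx.2]
    · rw [shellWeight_of_notMem hx, zero_mul]; exact bot_le
  refine (ENNReal.mul_le_mul_iff_left (shellVolume_ne_zero (2 * k)) (shellVolume_ne_top _)).1 ?_
  calc ENNReal.ofReal (12 / 25 * σ) * shellVolume (2 * k + 1)
      = ∫⁻ ω, ENNReal.ofReal (12 / 25 * σ) * shellVolume (2 * k + 1) ∂(R.P) := by simp
    _ ≤ ∫⁻ ω, (∫⁻ x : Fin (2 * k + 1) → ℝ,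
        shellWeight (∑ i, x i ^ 2) * ‖S (f x : X) - R.A ω (f x)‖ₑ) ∂(R.P) := lintegral_mono hlow
    _ = ∫⁻ x : Fin (2 * k + 1) → ℝ, ∫⁻ ω,
        shellWeight (∑ i, x i ^ 2) * ‖S (f x : X) - R.A ω (f x)‖ₑ ∂(R.P) :=
      (lintegral_lintegral_swap hGe.aemeasurable).symm
    _ ≤ ∫⁻ x : Fin (2 * k + 1) → ℝ, R.error * shellWeight (∑ i, x i ^ 2) := by
      refine lintegral_mono fun x => ?_
      rw [lintegral_const_mul' _ _ (ne_top_of_le_ne_top ENNReal.one_ne_top (shellWeight_le_one _)),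
        mul_comm (shellWeight _)]
      gcongr
      exact le_iSup (fun g : F => ∫⁻ ω, ‖S (g : X) - R.A ω g‖ₑ ∂(R.P)) (f x)
    _ = R.error * shellVolume (2 * k + 1) :=
      lintegral_const_mul _ (measurable_shellWeight.comp (by fun_prop))

/-- Randomized algorithms with `k` measurements cannot resolve a Euclidean ball of dimension `2k + 1`
on which `S` is bounded below. -/
theorem le_minErrRan (S : X →L[ℝ] Y) {F : Set X} (hF : Convex ℝ F) (k : ℕ) {σ : ℝ} (hσ : 0 ≤ σ)
    (c : X) (T : (Fin (2 * k + 1) → ℝ) →ₗ[ℝ] X)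
    (hTF : ∀ x : Fin (2 * k + 1) → ℝ, ∑ i, x i ^ 2 ≤ 1 → c + T x ∈ F)
    (hT : ∀ x, σ * √(∑ i, x i ^ 2) ≤ ‖S (T x)‖) :
    ENNReal.ofReal (12 / 25 * σ) ≤ minErrRan.{u, v, w} S F k := by
  refine le_iInf fun R => ?_
  have hsq : ∀ (a : ℝ) (x : Fin (2 * k + 1) → ℝ), ∑ i, (a • x) i ^ 2 = a ^ 2 * ∑ i, x i ^ 2 :=
    fun a x => by simp [mul_pow, Finset.mul_sum]
  have hqc : Continuous fun x : Fin (2 * k + 1) → ℝ => √(∑ i, x i ^ 2) := by fun_prop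
  -- Radial retraction to the unit ball makes the parametrization of inputs total and continuous
  -- without changing it on the shell.
  have hρF : ∀ x : Fin (2 * k + 1) → ℝ, c + T ((max 1 √(∑ i, x i ^ 2))⁻¹ • x) ∈ F := by
    intro x
    refine hTF _ ?_
    have h0 : 0 ≤ ∑ i, x i ^ 2 := Finset.sum_nonneg fun i _ => sq_nonneg _
    have h1 : (0 : ℝ) < max 1 √(∑ i, x i ^ 2) := lt_max_of_lt_left one_pos
    rw [hsq, inv_pow, inv_mul_le_one₀ (by positivity)]
    calc ∑ i, x i ^ 2 = √(∑ i, x i ^ 2) ^ 2 := (Real.sq_sqrt h0).symm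
      _ ≤ _ := by gcongr; exact le_max_right _ _
  have hsmall : ∀ (ε : ℝ), 0 < ε → ∀ x : Fin (2 * k + 1) → ℝ, √(∑ i, x i ^ 2) < ε →
      T x ∈ ε • (F - F) := by
    intro ε hε x hx
    have h2 : ∑ i, (ε⁻¹ • x) i ^ 2 ≤ 1 := by
      rw [hsq, inv_pow, inv_mul_le_one₀ (by positivity)]
      exact ((Real.sqrt_lt' hε).1 hx).le
    rw [Set.mem_smul_set_iff_inv_smul_mem₀ hε.ne', ← map_smul]
    exact ⟨_, hTF _ h2, c + T 0, hTF 0 (by simp), by simp⟩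
  let f : (Fin (2 * k + 1) → ℝ) → F := fun x => ⟨_, hρF x⟩
  have hρc : Continuous fun x : Fin (2 * k + 1) → ℝ => (max 1 √(∑ i, x i ^ 2))⁻¹ • x := by
    refine Continuous.smul (Continuous.inv₀ (continuous_const.max hqc) fun x => ?_) continuous_id
    exact (lt_max_of_lt_left one_pos).ne'
  have hfc : @Continuous _ F _ (inputTopology F) f := by
    refine continuous_inputTopology hF f fun z ε hε => ?_
    have h1 : Filter.Tendsto (fun z' : Fin (2 * k + 1) → ℝ =>
        √(∑ i, ((max 1 √(∑ i, z' i ^ 2))⁻¹ • z' - (max 1 √(∑ i, z i ^ 2))⁻¹ • z) i ^ 2))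
        (nhds z) (nhds 0) := by
      have := (hqc.comp (hρc.sub
        (continuous_const (y := (max 1 √(∑ i, z i ^ 2))⁻¹ • z)))).tendsto z
      simpa [Function.comp_def] using this
    filter_upwards [h1.eventually (eventually_lt_nhds hε)] with z' hz'
    have := hsmall ε hε _ hz'
    rw [map_sub] at this
    simpa [f] using this
  have hfm : @Measurable _ F _ (inputMeasurableSpace F) f := by
    let : TopologicalSpace F := inputTopology F
    let : MeasurableSpace F := inputMeasurableSpace F
    have : BorelSpace F := ⟨rfl⟩
    exact hfc.measurable
  refine le_error_of_measurable S k hσ c T hT f hfm (fun x hx => ?_) R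
  have : max 1 √(∑ i, x i ^ 2) = 1 := max_eq_left (Real.sqrt_le_one.2 hx)
  simp [f, this, add_comm]

end RandomizedLowerBound

/-! ### Singular values and determinants -/

section SingularValues

/-- `T` is bounded below by its `k`-th singular value on an isometric copy of `ℝᵏ⁺¹`. -/
theorem LinearMap.exists_isometry_singularValues_le {E E' : Type*} [NormedAddCommGroup E]
    [InnerProductSpace ℝ E] [FiniteDimensional ℝ E] [NormedAddCommGroup E']
    [InnerProductSpace ℝ E'] [FiniteDimensional ℝ E'] (T : E →ₗ[ℝ] E') {m k : ℕ}
    (hm : Module.finrank ℝ E = m) (hk : k < m) :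
    ∃ V : (Fin (k + 1) → ℝ) →ₗ[ℝ] E, (∀ x, ‖V x‖ ^ 2 = ∑ i, x i ^ 2) ∧
      ∀ x, T.singularValues k ^ 2 * ∑ i, x i ^ 2 ≤ ‖T (V x)‖ ^ 2 := by
  let b := T.isSymmetric_adjoint_comp_self.eigenvectorBasis hm
  let b' : Fin (k + 1) → E := fun i => b (Fin.castLE hk i)
  have hb' : Orthonormal ℝ b' := b.orthonormal.comp _ (Fin.castLE_injective hk)
  have hinner : ∀ x z : Fin (k + 1) → ℝ,
      inner ℝ (∑ i, x i • b' i) (∑ i, z i • b' i) = ∑ i, x i * z i := fun x z => by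
    rw [hb'.inner_sum]; simp
  have hV : ∀ x : Fin (k + 1) → ℝ, Fintype.linearCombination ℝ b' x = ∑ i, x i • b' i :=
    fun x => Fintype.linearCombination_apply _ _ _
  refine ⟨Fintype.linearCombination ℝ b', fun x => ?_, fun x => ?_⟩
  · rw [hV, ← real_inner_self_eq_norm_sq, hinner]
    simp_rw [sq]
  -- The chosen vectors are eigenvectors of the adjoint times `T`, so `‖T (V x)‖ ^ 2` is a diagonal
  -- quadratic form.
  · have hT : (T.adjoint ∘ₗ T) (∑ i, x i • b' i) =
        ∑ i : Fin (k + 1), (T.singularValues (i : ℕ) ^ 2 * x i) • b' i := by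
      rw [map_sum]
      refine Finset.sum_congr rfl fun i _ => ?_
      have h1 : T.singularValues (i : ℕ) ^ 2 =
          T.isSymmetric_adjoint_comp_self.eigenvalues hm (Fin.castLE hk i) :=
        T.sq_singularValues_fin hm (Fin.castLE hk i)
      rw [map_smul, T.isSymmetric_adjoint_comp_self.apply_eigenvectorBasis hm, ← h1, smul_smul,
        mul_comm]
      rfl
    rw [hV, ← real_inner_self_eq_norm_sq, ← LinearMap.adjoint_inner_left, ← LinearMap.comp_apply,
      hT, hinner, Finset.mul_sum]
    refine Finset.sum_le_sum fun i _ => ?_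
    have h2 : T.singularValues k ≤ T.singularValues (i : ℕ) :=
      T.singularValues_antitone (Nat.lt_succ_iff.1 i.2)
    have h3 := T.singularValues_nonneg k
    calc T.singularValues k ^ 2 * x i ^ 2 ≤ T.singularValues (i : ℕ) ^ 2 * x i ^ 2 := by gcongr
      _ = _ := by ring

theorem Matrix.prod_singularValues_toEuclideanLin {m : ℕ} (M : Matrix (Fin m) (Fin m) ℝ) :
    ∏ i ∈ Finset.range m, (Matrix.toEuclideanLin M).singularValues i = |M.det| := by
  have h1 := (Matrix.toEuclideanLin M).normDet_eq_prod_singularValues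
  rw [LinearMap.normDet_eq_abs_det, finrank_euclideanSpace_fin] at h1
  rw [← h1, Matrix.toEuclideanLin_eq_toLin_orthonormal, LinearMap.det_toLin]

end SingularValues

theorem Finset.prod_range_two_mul_le_sq {s : ℕ → ℝ} (hs : Antitone s) (h0 : ∀ i, 0 ≤ s i) (n : ℕ) :
    ∏ j ∈ Finset.range (2 * n), s j ≤ (∏ k ∈ Finset.range n, s (2 * k)) ^ 2 := by
  induction n with
  | zero => simp
  | succ n ih =>
    rw [show 2 * (n + 1) = 2 * n + 1 + 1 by ring, Finset.prod_range_succ, Finset.prod_range_succ,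
      Finset.prod_range_succ, mul_pow, mul_assoc, sq (s (2 * n))]
    have h1 := hs (Nat.le_succ (2 * n))
    have h2 : 0 ≤ ∏ j ∈ Finset.range (2 * n), s j := Finset.prod_nonneg fun i _ => h0 i
    exact mul_le_mul ih (mul_le_mul_of_nonneg_left h1 (h0 _)) (mul_nonneg (h0 _) (h0 _))
      (by positivity)

/-! ### From singular values to randomized errors -/

section DeterminantBound

variable {X : Type u} {Y : Type v} [NormedAddCommGroup X] [NormedSpace ℝ X]
  [NormedAddCommGroup Y] [NormedSpace ℝ Y]

/-- Up to the factor `r`, every coordinate of `M z` is a value of some `l i` at `S (D z)`, hence at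
most its norm. Summing `m` squares costs `√m`; the factor `25/12` inverts the `12/25` of the shell
bound. -/
theorem singularValues_le_minErrRan (S : X →L[ℝ] Y) {F : Set X} (hF : Convex ℝ F) {m : ℕ}
    (u : Fin m → X) (l : Fin m → (Y →L[ℝ] ℝ)) (hl : ∀ i y, |l i y| ≤ ‖y‖) (c : X) {r : ℝ}
    (hr : 0 < r) (hball : ∀ x : Fin m → ℝ, ∑ i, x i ^ 2 ≤ 1 → c + r • ∑ i, x i • u i ∈ F)
    {k : ℕ} (hk : 2 * k < m) :
    ENNReal.ofReal ((Matrix.toEuclideanLin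
        (Matrix.of fun i j => l i (S (u j)))).singularValues (2 * k)) ≤
      ENNReal.ofReal (25 / 12 * √m / r) * minErrRan.{u, v, w} S F k := by
  set M : Matrix (Fin m) (Fin m) ℝ := Matrix.of fun i j => l i (S (u j)) with hM
  set σ := (Matrix.toEuclideanLin M).singularValues (2 * k) with hσ
  have hσ0 : 0 ≤ σ := (Matrix.toEuclideanLin M).singularValues_nonneg _
  have hm : (0 : ℝ) < m := by
    have : 0 < m := by omega
    exact_mod_cast this
  have hsm : 0 < √(m : ℝ) := Real.sqrt_pos.2 hm
  obtain ⟨V, hV1, hV2⟩ := (Matrix.toEuclideanLin M).exists_isometry_singularValues_le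
    finrank_euclideanSpace_fin hk
  let D : EuclideanSpace ℝ (Fin m) →ₗ[ℝ] X :=
    r • ((Fintype.linearCombination ℝ u).comp (WithLp.linearEquiv 2 ℝ (Fin m → ℝ)).toLinearMap)
  have hD : ∀ z, D z = r • ∑ i, z i • u i := fun z => by
    simp [D, Fintype.linearCombination_apply]
  have hlD : ∀ z i, l i (S (D z)) = r * Matrix.toEuclideanLin M z i := fun z i => by
    rw [hD, map_smul, map_smul, smul_eq_mul, map_sum, map_sum]
    congr 1
    simp [Matrix.toEuclideanLin, Matrix.mulVec, dotProduct, hM, mul_comm]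
  have key := le_minErrRan.{u, v, w} S hF k (σ := r / √m * σ) (by positivity) c (D.comp V)
    (fun x hx => ?_) (fun x => ?_)
  · calc ENNReal.ofReal σ = ENNReal.ofReal (25 / 12 * √m / r) *
          ENNReal.ofReal (12 / 25 * (r / √m * σ)) := by
          rw [← ENNReal.ofReal_mul (by positivity)]
          congr 1
          field_simp
      _ ≤ _ := by gcongr
  · rw [LinearMap.comp_apply, hD]
    refine hball _ ?_
    rw [← EuclideanSpace.real_norm_sq_eq, hV1]
    exact hx
  · rw [LinearMap.comp_apply]
    refine abs_le_of_sq_le_sq' ?_ (norm_nonneg _) |>.2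
    have h1 : r ^ 2 * ‖Matrix.toEuclideanLin M (V x)‖ ^ 2 ≤ m * ‖S (D (V x))‖ ^ 2 := by
      rw [EuclideanSpace.real_norm_sq_eq, Finset.mul_sum]
      calc _ ≤ ∑ i : Fin m, ‖S (D (V x))‖ ^ 2 := by
            refine Finset.sum_le_sum fun i _ => ?_
            rw [← mul_pow, ← hlD, ← sq_abs]
            exact pow_le_pow_left₀ (abs_nonneg _) (hl _ _) 2
        _ = _ := by simp
    have h2 := hV2 x
    have h3 : 0 ≤ ∑ i, x i ^ 2 := Finset.sum_nonneg fun i _ => sq_nonneg _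
    rw [mul_pow, mul_pow, div_pow, Real.sq_sqrt hm.le, Real.sq_sqrt h3, mul_assoc, div_mul_eq_mul_div,
      div_le_iff₀ hm, mul_comm _ (m : ℝ)]
    exact (mul_le_mul_of_nonneg_left h2 (sq_nonneg r)).trans h1

/-- Determinant bound: the diagonal of a triangular matrix `(lᵢ (S uⱼ))` is controlled by the randomized
errors when `F` contains the image of a Euclidean ball spanned by the `uⱼ`. -/
theorem prod_le_prod_minErrRan (S : X →L[ℝ] Y) {F : Set X} (hF : Convex ℝ F) (n : ℕ)
    (u : Fin (2 * n) → X) (l : Fin (2 * n) → (Y →L[ℝ] ℝ)) (hl : ∀ i y, |l i y| ≤ ‖y‖)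
    (htri : ∀ i j, i < j → l i (S (u j)) = 0) (c : X) {r : ℝ} (hr : 0 < r)
    (hball : ∀ x : Fin (2 * n) → ℝ, ∑ i, x i ^ 2 ≤ 1 → c + r • ∑ i, x i • u i ∈ F) :
    ∏ i, ‖l i (S (u i))‖ₑ ≤ (ENNReal.ofReal (25 / 12 * √(2 * n) / r) ^ n *
      ∏ k ∈ Finset.range n, minErrRan.{u, v, w} S F k) ^ 2 := by
  set M : Matrix (Fin (2 * n)) (Fin (2 * n)) ℝ := Matrix.of fun i j => l i (S (u j)) with hM
  have h0 := (Matrix.toEuclideanLin M).singularValues_nonneg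
  have hdet : M.det = ∏ i, l i (S (u i)) :=
    Matrix.det_of_isLowerTriangular M fun i j hij => htri i j hij
  calc ∏ i, ‖l i (S (u i))‖ₑ = ENNReal.ofReal |M.det| := by
        rw [hdet, Finset.abs_prod, ENNReal.ofReal_prod_of_nonneg fun _ _ => abs_nonneg _]
        simp_rw [Real.enorm_eq_ofReal_abs]
    _ ≤ ENNReal.ofReal
        ((∏ k ∈ Finset.range n, (Matrix.toEuclideanLin M).singularValues (2 * k)) ^ 2) := by
        rw [← Matrix.prod_singularValues_toEuclideanLin]
        exact ENNReal.ofReal_le_ofReal (Finset.prod_range_two_mul_le_sq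
          (Matrix.toEuclideanLin M).singularValues_antitone h0 n)
    _ = (∏ k ∈ Finset.range n,
        ENNReal.ofReal ((Matrix.toEuclideanLin M).singularValues (2 * k))) ^ 2 := by
        rw [ENNReal.ofReal_pow (Finset.prod_nonneg fun i _ => h0 _),
          ENNReal.ofReal_prod_of_nonneg fun i _ => h0 _]
    _ ≤ (∏ k ∈ Finset.range n, (ENNReal.ofReal (25 / 12 * √(2 * n) / r) *
        minErrRan.{u, v, w} S F k)) ^ 2 := by
        gcongr with k hk
        have := singularValues_le_minErrRan.{u, v, w} S hF u l hl c hr hball (k := k)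
          (by have := Finset.mem_range.1 hk; omega)
        simpa using this
    _ = _ := by rw [Finset.prod_mul_distrib, Finset.prod_const, Finset.card_range]

end DeterminantBound

/-! ### Greedy lower certificates for deterministic errors -/

section Deterministic

variable {X : Type u} {Y : Type v} [NormedAddCommGroup X] [NormedSpace ℝ X]
  [NormedAddCommGroup Y] [NormedSpace ℝ Y]

theorem IsNormingSet.nonempty {N : Set (Y →L[ℝ] ℝ)} (hN : IsNormingSet N) : N.Nonempty := by
  by_contra h
  rw [Set.not_nonempty_iff_eq_empty] at h
  have h1 := (hN 0).2 (show (-1 : ℝ) ∈ _ by simp [h])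
  rw [norm_zero] at h1
  linarith

theorem IsNormingSet.abs_le {N : Set (Y →L[ℝ] ℝ)} (hN : IsNormingSet N) {l : Y →L[ℝ] ℝ}
    (hl : l ∈ N) (y : Y) : |l y| ≤ ‖y‖ :=
  (hN y).1 ⟨l, hl, rfl⟩

theorem IsNormingSet.enorm_le {N : Set (Y →L[ℝ] ℝ)} (hN : IsNormingSet N) {y : Y} {a : ℝ≥0∞}
    (h : ∀ l ∈ N, ‖l y‖ₑ ≤ a) : ‖y‖ₑ ≤ a := by
  rcases eq_or_ne a ∞ with rfl | ha
  · exact le_top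
  · rw [← ofReal_norm]
    refine ENNReal.ofReal_le_of_le_toReal ((hN y).2 ?_)
    rintro _ ⟨l, hl, rfl⟩
    have := ENNReal.toReal_mono ha (h l hl)
    simpa using this

theorem minErrDetNon_succ_le (S : X →L[ℝ] Y) (F : Set X) {Lam : Set (X →L[ℝ] ℝ)}
    (hLam : Lam.Nonempty) (k : ℕ) : minErrDetNon S F Lam (k + 1) ≤ minErrDetNon S F Lam k := by
  obtain ⟨l, hl⟩ := hLam
  refine le_iInf fun L => le_iInf fun hL => le_iInf fun φ => ?_
  refine iInf_le_of_le (Fin.snoc (α := fun _ => X →L[ℝ] ℝ) L l) (iInf_le_of_le ?_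
    (iInf_le_of_le (fun v => φ (Fin.init v)) (le_of_eq ?_)))
  · intro i
    refine Fin.lastCases ?_ (fun j => ?_) i
    · simpa using hl
    · simpa using hL j
  · refine iSup_congr fun f => ?_
    have h : (Fin.init fun i => (Fin.snoc (α := fun _ => X →L[ℝ] ℝ) L l : Fin (k + 1) → _) i (f : X)) =
        fun i => L i (f : X) := by
      ext i
      simp [Fin.init]
    exact congrArg (fun v => ‖S (f : X) - φ v‖ₑ) h

theorem minErrDetNon_antitone (S : X →L[ℝ] Y) (F : Set X) {Lam : Set (X →L[ℝ] ℝ)}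
    (hLam : Lam.Nonempty) : Antitone (minErrDetNon S F Lam) :=
  antitone_nat_of_succ_le (minErrDetNon_succ_le S F hLam)

/-- Otherwise the reconstruction that returns `S g` for any `g ∈ F` consistent with the data would
have error at most `a`. -/
theorem exists_lt_enorm_of_lt_minErrDetNon (S : X →L[ℝ] Y) {N : Set (Y →L[ℝ] ℝ)}
    (hN : IsNormingSet N) {Lam : Set (X →L[ℝ] ℝ)} (hLam : ∀ l ∈ N, l.comp S ∈ Lam) {F : Set X}
    {k : ℕ} {a : ℝ≥0∞} (ha : a < minErrDetNon S F Lam k) (l : Fin k → (Y →L[ℝ] ℝ))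
    (hl : ∀ i, l i ∈ N) :
    ∃ f ∈ F, ∃ g ∈ F, ∃ l' ∈ N, (∀ i, l i (S (f - g)) = 0) ∧ a < ‖l' (S (f - g))‖ₑ := by
  by_contra! h
  refine ha.not_ge ?_
  classical
  let φ : (Fin k → ℝ) → Y := fun v =>
    if hv : ∃ g ∈ F, ∀ i, l i (S g) = v i then S hv.choose else 0
  refine iInf_le_of_le (fun i => (l i).comp S) (iInf_le_of_le (fun i => hLam _ (hl i))
    (iInf_le_of_le φ (iSup_le fun f => ?_)))
  have hv : ∃ g ∈ F, ∀ i, l i (S g) = (l i).comp S f := ⟨f, f.2, fun i => rfl⟩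
  have hφ : φ (fun i => (l i).comp S f) = S hv.choose := dif_pos hv
  rw [hφ, ← map_sub]
  refine hN.enorm_le fun l' hl' => h f f.2 _ hv.choose_spec.1 l' hl' fun i => ?_
  rw [map_sub, map_sub, hv.choose_spec.2 i, ContinuousLinearMap.comp_apply, sub_self]

/-- Greedy choice of pairs of inputs and functionals with a triangular matrix and a large diagonal. -/
theorem exists_triangular_of_lt_minErrDetNon (S : X →L[ℝ] Y) {N : Set (Y →L[ℝ] ℝ)}
    (hN : IsNormingSet N) {Lam : Set (X →L[ℝ] ℝ)} (hLam : ∀ l ∈ N, l.comp S ∈ Lam) {F : Set X}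
    (m : ℕ) {a : ℕ → ℝ≥0∞} (ha : ∀ k < m, a k < minErrDetNon S F Lam k) :
    ∃ (f g : Fin m → X) (l : Fin m → (Y →L[ℝ] ℝ)), (∀ k, f k ∈ F) ∧ (∀ k, g k ∈ F) ∧
      (∀ k, l k ∈ N) ∧ (∀ i k, i < k → l i (S (f k - g k)) = 0) ∧
      ∀ k : Fin m, a k < ‖l k (S (f k - g k))‖ₑ := by
  induction m with
  | zero =>
    exact ⟨Fin.elim0, Fin.elim0, Fin.elim0, fun k => k.elim0, fun k => k.elim0, fun k => k.elim0,
      fun k => k.elim0, fun k => k.elim0⟩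
  | succ m ih =>
    obtain ⟨f, g, l, hf, hg, hl, htri, hlt⟩ := ih fun k hk => ha k (hk.trans (Nat.lt_succ_self m))
    obtain ⟨f', hf', g', hg', l', hl', htri', hlt'⟩ :=
      exists_lt_enorm_of_lt_minErrDetNon S hN hLam (ha m (Nat.lt_succ_self m)) l hl
    refine ⟨Fin.snoc (α := fun _ => X) f f', Fin.snoc (α := fun _ => X) g g',
      Fin.snoc (α := fun _ => Y →L[ℝ] ℝ) l l', ?_, ?_, ?_, ?_, ?_⟩
    · exact Fin.lastCases (by simpa using hf') (fun j => by simpa using hf j)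
    · exact Fin.lastCases (by simpa using hg') (fun j => by simpa using hg j)
    · exact Fin.lastCases (by simpa using hl') (fun j => by simpa using hl j)
    · intro i k
      refine Fin.lastCases (fun hik => ?_) (fun k' => ?_) k
      · obtain ⟨i', rfl⟩ := Fin.exists_castSucc_eq.2 hik.ne
        simpa using htri' i'
      · intro hik
        obtain ⟨i', rfl⟩ := Fin.exists_castSucc_eq.2 (hik.trans (Fin.castSucc_lt_last k')).ne
        simpa using htri i' k' (by simpa using hik)
    · exact Fin.lastCases (by simpa using hlt') (fun j => by simpa using hlt j)

end Deterministic

/-- The greedy choice only reaches values strictly below the errors, which may be infinite. In the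
induction `K` absorbs the factors already fixed. -/
theorem ENNReal.mul_prod_le_of_forall_lt {m : ℕ} {c : ℕ → ℝ≥0∞} {K B : ℝ≥0∞}
    (h : ∀ a : ℕ → ℝ≥0∞, (∀ k < m, a k < c k) → K * ∏ k ∈ Finset.range m, a k ≤ B) :
    K * ∏ k ∈ Finset.range m, c k ≤ B := by
  induction m generalizing K with
  | zero => simpa using h 0
  | succ m ih =>
    rw [Finset.prod_range_succ, ← mul_assoc]
    refine ENNReal.mul_le_of_forall_lt fun a' ha' b hb => ?_
    refine le_trans (mul_le_mul_left ha'.le b) ?_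
    rw [mul_right_comm]
    refine ih fun a ha => ?_
    have := h (Function.update a m b) fun k hk => ?_
    · rw [Finset.prod_range_succ, Function.update_self, Finset.prod_congr rfl fun k hk =>
        Function.update_of_ne (Finset.mem_range.1 hk).ne b a] at this
      rwa [mul_right_comm, mul_assoc]
    · rcases (Nat.lt_succ_iff.1 hk).eq_or_lt with rfl | hk'
      · rwa [Function.update_self]
      · rw [Function.update_of_ne hk'.ne]; exact ha k hk'

/-! ### Euclidean balls inside convex sets -/

section Geometry

variable {X : Type u} [NormedAddCommGroup X] [NormedSpace ℝ X]

theorem abs_le_one_of_sum_sq_le_one {m : ℕ} {x : Fin m → ℝ} (hx : ∑ i, x i ^ 2 ≤ 1) (i : Fin m) :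
    |x i| ≤ 1 :=
  (sq_le_one_iff_abs_le_one _).1
    ((Finset.single_le_sum (fun j _ => sq_nonneg (x j)) (Finset.mem_univ i)).trans hx)

/-- The point is the average of `m` points, one on each segment from `g i` to `f i`. -/
theorem Convex.midpoint_add_sum_sub_mem {F : Set X} (hF : Convex ℝ F) {m : ℕ} (hm : 0 < m)
    {f g : Fin m → X} (hf : ∀ i, f i ∈ F) (hg : ∀ i, g i ∈ F) {x : Fin m → ℝ}
    (hx : ∀ i, |x i| ≤ 1) :
    (1 / (2 * m : ℝ)) • ∑ i, (f i + g i) + (1 / (2 * m : ℝ)) • ∑ i, x i • (f i - g i) ∈ F := by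
  have hm' : (0 : ℝ) < m := by exact_mod_cast hm
  have h : ∀ i, ((1 + x i) / 2) • f i + ((1 - x i) / 2) • g i ∈ F := fun i => by
    have := abs_le.1 (hx i)
    exact hF (hf i) (hg i) (by linarith) (by linarith) (by ring)
  have h2 := hF.sum_mem (t := Finset.univ) (w := fun _ : Fin m => 1 / (m : ℝ))
    (fun i _ => by positivity) (by simp [hm'.ne']) (fun i _ => h i)
  convert h2 using 1
  rw [← smul_add, ← Finset.sum_add_distrib, Finset.smul_sum]
  refine Finset.sum_congr rfl fun i _ => ?_
  match_scalars <;> ring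

theorem Convex.sum_smul_mem_of_symmetric {F : Set X} (hF : Convex ℝ F) (hsymm : ∀ x ∈ F, -x ∈ F)
    (h0 : (0 : X) ∈ F) {m : ℕ} {h : Fin m → X} (hh : ∀ i, h i ∈ F) {t : Fin m → ℝ}
    (ht : ∑ i, |t i| ≤ 1) : ∑ i, t i • h i ∈ F := by
  have h1 : ∀ i, ∃ h' ∈ F, t i • h i = |t i| • h' := fun i => by
    rcases le_total 0 (t i) with h2 | h2
    · exact ⟨h i, hh i, by rw [abs_of_nonneg h2]⟩
    · exact ⟨-h i, hsymm _ (hh i), by rw [abs_of_nonpos h2, smul_neg, neg_smul, neg_neg]⟩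
  choose h' hh' heq using h1
  have hs : 0 ≤ ∑ i, |t i| := Finset.sum_nonneg fun i _ => abs_nonneg _
  rcases hs.eq_or_lt with hs0 | hs0
  · have : ∀ i, t i = 0 := fun i => abs_eq_zero.1
      ((Finset.sum_eq_zero_iff_of_nonneg fun i _ => abs_nonneg _).1 hs0.symm i (Finset.mem_univ i))
    simpa [this] using h0
  · have h2 := hF.sum_mem (t := Finset.univ) (w := fun i => |t i| / ∑ i, |t i|)
      (fun i _ => by positivity) (by rw [← Finset.sum_div, div_self hs0.ne']) (fun i _ => hh' i)
    have h3 := hF.smul_mem_of_zero_mem h0 h2 ⟨hs, ht⟩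
    convert h3 using 1
    rw [Finset.smul_sum]
    refine Finset.sum_congr rfl fun i _ => ?_
    rw [heq, smul_smul, mul_div_cancel₀ _ hs0.ne']

/-- The half differences lie in `F`, hence so does their symmetric convex hull; by Cauchy–Schwarz
the `ℓ¹` norm is at most `√m` times the `ℓ²` norm. -/
theorem Convex.sum_sub_mem_of_symmetric {F : Set X} (hF : Convex ℝ F) (hsymm : ∀ x ∈ F, -x ∈ F)
    {m : ℕ} (hm : 0 < m) {f g : Fin m → X} (hf : ∀ i, f i ∈ F) (hg : ∀ i, g i ∈ F)
    {x : Fin m → ℝ} (hx : ∑ i, x i ^ 2 ≤ 1) :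
    (1 / (2 * √m) : ℝ) • ∑ i, x i • (f i - g i) ∈ F := by
  have hm' : (0 : ℝ) < √m := Real.sqrt_pos.2 (by exact_mod_cast hm)
  have hh : ∀ i, (1 / 2 : ℝ) • f i + (1 / 2 : ℝ) • (-g i) ∈ F := fun i =>
    hF (hf i) (hsymm _ (hg i)) (by norm_num) (by norm_num) (by norm_num)
  have h0 : (0 : X) ∈ F := by
    have := hF (hf ⟨0, hm⟩) (hsymm _ (hf ⟨0, hm⟩)) (a := 1 / 2) (b := 1 / 2) (by norm_num)
      (by norm_num) (by norm_num)
    rwa [smul_neg, add_neg_cancel] at this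
  have ht : ∑ i, |x i / √m| ≤ 1 := by
    have h1 : (∑ i, |x i|) ^ 2 ≤ m * ∑ i, |x i| ^ 2 := by
      simpa using sq_sum_le_card_mul_sum_sq (s := Finset.univ) (f := fun i => |x i|)
    simp_rw [sq_abs] at h1
    simp_rw [abs_div, abs_of_pos hm']
    rw [← Finset.sum_div, div_le_one hm']
    refine Real.le_sqrt_of_sq_le (h1.trans ?_)
    exact mul_le_of_le_one_right (by positivity) hx
  convert hF.sum_smul_mem_of_symmetric hsymm h0 hh ht using 1
  rw [Finset.smul_sum]
  refine Finset.sum_congr rfl fun i _ => ?_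
  match_scalars <;> ring

end Geometry

/-! ### Orthonormalization in the Hilbert case -/

section Orthonormalization

variable {X : Type u} [NormedAddCommGroup X] [InnerProductSpace ℝ X]

/-- Reverse Gram-Schmidt orthonormalization keeps the matrix triangular and does not decrease its
diagonal. -/
theorem exists_orthonormal_triangular {m : ℕ} (h : Fin m → X) (hh : ∀ i, ‖h i‖ ≤ 1)
    (ψ : Fin m → (X →L[ℝ] ℝ)) (htri : ∀ i k, i < k → ψ i (h k) = 0) (hd : ∀ k, ψ k (h k) ≠ 0) :
    ∃ q : Fin m → X, Orthonormal ℝ q ∧ (∀ i k, i < k → ψ i (q k) = 0) ∧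
      ∀ k, ‖ψ k (h k)‖ₑ ≤ ‖ψ k (q k)‖ₑ := by
  -- Projecting out later vectors rather than earlier ones leaves `ψ i (h k)` unchanged for `i ≤ k`,
  -- because `ψ i` vanishes on all `h j` with `j > i`.
  let U : Fin m → Submodule ℝ X := fun k => Submodule.span ℝ (h '' Set.Ioi k)
  have hfin : ∀ k, FiniteDimensional ℝ (U k) := fun k =>
    FiniteDimensional.span_of_finite ℝ (Set.toFinite _)
  let p : Fin m → X := fun k => h k - (U k).starProjection (h k)
  have hψU : ∀ i k, i ≤ k → ∀ z ∈ U k, ψ i z = 0 := fun i k hik z hz => by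
    have h1 : U k ≤ LinearMap.ker (ψ i : X →ₗ[ℝ] ℝ) := by
      refine Submodule.span_le.2 ?_
      rintro _ ⟨j, hj, rfl⟩
      exact htri i j (hik.trans_lt hj)
    exact h1 hz
  have hψp : ∀ i k, i ≤ k → ψ i (p k) = ψ i (h k) := fun i k hik => by
    simp only [p]
    rw [map_sub, hψU i k hik _ (Submodule.starProjection_apply_mem _ _), sub_zero]
  have hp0 : ∀ k, p k ≠ 0 := fun k hk => hd k (by rw [← hψp k k le_rfl, hk, map_zero])
  have hp1 : ∀ k, ‖p k‖ ≤ 1 := fun k => by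
    have h1 : p k = (U k)ᗮ.starProjection (h k) := by
      simp [p, Submodule.starProjection_orthogonal']
    rw [h1]
    exact ((U k)ᗮ.norm_starProjection_apply_le _).trans (hh k)
  have hpU : ∀ k, p k ∈ (U k)ᗮ := fun k => Submodule.sub_starProjection_mem_orthogonal _
  have hpU' : ∀ j k, j < k → p k ∈ U j := fun j k hjk => by
    refine Submodule.sub_mem _ (Submodule.subset_span ⟨k, hjk, rfl⟩) ?_
    refine Submodule.span_mono (Set.image_mono fun i hi => ?_)
      (Submodule.starProjection_apply_mem (U k) _)
    exact lt_trans hjk hi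
  have horth : ∀ j k, j < k → inner ℝ (p j) (p k) = 0 := fun j k hjk =>
    Submodule.inner_left_of_mem_orthogonal (hpU' j k hjk) (hpU j)
  refine ⟨fun k => ‖p k‖⁻¹ • p k, ⟨fun k => ?_, fun j k hjk => ?_⟩, fun i k hik => ?_, fun k => ?_⟩
  · rw [norm_smul, norm_inv, norm_norm, inv_mul_cancel₀ (norm_ne_zero_iff.2 (hp0 k))]
  · simp only [inner_smul_left, inner_smul_right]
    rcases lt_or_gt_of_ne hjk with h1 | h1
    · rw [horth j k h1]; simp
    · rw [real_inner_comm, horth k j h1]; simp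
  · rw [map_smul, hψp i k hik.le, htri i k hik, smul_zero]
  · rw [map_smul, hψp k k le_rfl, Real.enorm_eq_ofReal_abs, Real.enorm_eq_ofReal_abs]
    refine ENNReal.ofReal_le_ofReal ?_
    rw [smul_eq_mul, abs_mul, abs_inv, abs_norm]
    exact le_mul_of_one_le_left (abs_nonneg _)
      ((one_le_inv₀ (norm_pos_iff.2 (hp0 k))).2 (hp1 k))

theorem Orthonormal.norm_sum_smul_le_one {m : ℕ} {q : Fin m → X} (hq : Orthonormal ℝ q)
    {x : Fin m → ℝ} (hx : ∑ i, x i ^ 2 ≤ 1) : ‖∑ i, x i • q i‖ ≤ 1 := by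
  refine (sq_le_one_iff₀ (norm_nonneg _)).1 ?_
  rw [← real_inner_self_eq_norm_sq, hq.inner_sum]
  simpa [sq] using hx

end Orthonormalization

/-! ### Geometric means in `ℝ≥0∞` -/

section GeometricMeans

theorem Antitone.le_geom_mean {c : ℕ → ℝ≥0∞} (hc : Antitone c) {m : ℕ} (hm : 0 < m) {r : ℝ}
    (hr : r = m) : c (m - 1) ≤ (∏ k ∈ Finset.range m, c k) ^ (1 / r) := by
  have hm' : (0 : ℝ) < m := by exact_mod_cast hm
  rw [one_div, hr, ENNReal.le_rpow_inv_iff hm', ENNReal.rpow_natCast]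
  calc c (m - 1) ^ m = ∏ k ∈ Finset.range m, c (m - 1) := by simp
    _ ≤ _ := Finset.prod_le_prod' fun k hk => hc (by have := Finset.mem_range.1 hk; omega)

theorem Antitone.geom_mean_two_mul_le {c : ℕ → ℝ≥0∞} (hc : Antitone c) {m : ℕ} {r : ℝ}
    (hr : 0 < r) :
    (∏ k ∈ Finset.range (2 * m), c k) ^ (1 / (2 * r)) ≤ (∏ k ∈ Finset.range m, c k) ^ (1 / r) := by
  have h : ∏ k ∈ Finset.range (2 * m), c k ≤ (∏ k ∈ Finset.range m, c k) ^ 2 := by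
    rw [two_mul, Finset.prod_range_add, sq]
    gcongr with k hk
    exact hc (Nat.le_add_left _ _)
  refine (ENNReal.rpow_le_rpow h (by positivity)).trans (le_of_eq ?_)
  rw [← ENNReal.rpow_natCast, ← ENNReal.rpow_mul]
  congr 1
  field_simp
  norm_num

theorem ENNReal.geom_mean_le_of_le {P Q D : ℝ≥0∞} {n : ℕ} (hn : 1 ≤ n) (h : P ≤ (D ^ n * Q) ^ 2) :
    P ^ (1 / (2 * n : ℝ)) ≤ D * Q ^ (1 / (n : ℝ)) := by
  have hn' : (0 : ℝ) < n := by exact_mod_cast hn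
  refine (ENNReal.rpow_le_rpow h (by positivity)).trans (le_of_eq ?_)
  rw [← ENNReal.rpow_natCast, ← ENNReal.rpow_mul,
    show ((2 : ℕ) : ℝ) * (1 / (2 * n)) = 1 / n by push_cast; field_simp,
    ENNReal.mul_rpow_of_nonneg _ _ (by positivity), ← ENNReal.rpow_natCast, ← ENNReal.rpow_mul,
    mul_one_div_cancel hn'.ne', ENNReal.rpow_one]

theorem ENNReal.ofReal_le_ofNat_mul_natCast_rpow {n : ℕ} (hn : 1 ≤ n) {D p : ℝ}
    (h : D ≤ 12 * (n : ℝ) ^ p) : ENNReal.ofReal D ≤ 12 * (n : ℝ≥0∞) ^ p := by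
  have hn' : (0 : ℝ) < n := by exact_mod_cast hn
  refine (ENNReal.ofReal_le_ofReal h).trans (le_of_eq ?_)
  rw [ENNReal.ofReal_mul (by norm_num), ← ENNReal.ofReal_rpow_of_pos hn', ENNReal.ofReal_natCast,
    ENNReal.ofReal_ofNat]

end GeometricMeans

/-! ### Assembling the inequalities -/

section MainInequalities

variable {X : Type u} {Y : Type v} [NormedAddCommGroup Y] [NormedSpace ℝ Y]

theorem geom_mean_minErrDetNon_le [NormedAddCommGroup X] [NormedSpace ℝ X] (S : X →L[ℝ] Y)
    {N : Set (Y →L[ℝ] ℝ)} (hN : IsNormingSet N)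
    {Lam : Set (X →L[ℝ] ℝ)} (hLam : ∀ l ∈ N, l.comp S ∈ Lam) {F : Set X} (hF : Convex ℝ F)
    {n : ℕ} (hn : 1 ≤ n) {r : ℝ} (hr : 0 < r)
    (hball : ∀ f g : Fin (2 * n) → X, (∀ k, f k ∈ F) → (∀ k, g k ∈ F) → ∃ c : X,
      ∀ x : Fin (2 * n) → ℝ, ∑ i, x i ^ 2 ≤ 1 → c + r • ∑ i, x i • (f i - g i) ∈ F) :
    (∏ k ∈ Finset.range (2 * n), minErrDetNon S F Lam k) ^ (1 / (2 * n : ℝ)) ≤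
      ENNReal.ofReal (25 / 12 * √(2 * n) / r) *
        (∏ k ∈ Finset.range n, minErrRan.{u, v, w} S F k) ^ (1 / (n : ℝ)) := by
  refine ENNReal.geom_mean_le_of_le hn ?_
  rw [← one_mul (∏ k ∈ Finset.range (2 * n), minErrDetNon S F Lam k)]
  refine ENNReal.mul_prod_le_of_forall_lt fun a ha => ?_
  obtain ⟨f, g, l, hf, hg, hl, htri, hlt⟩ := exists_triangular_of_lt_minErrDetNon S hN hLam _ ha
  obtain ⟨c, hc⟩ := hball f g hf hg
  rw [one_mul, ← Fin.prod_univ_eq_prod_range]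
  exact (Finset.prod_le_prod' fun k _ => (hlt k).le).trans
    (prod_le_prod_minErrRan S hF n (fun k => f k - g k) l (fun i => hN.abs_le (hl i)) htri c hr hc)

theorem geom_mean_minErrDetNon_closedBall_le [NormedAddCommGroup X] [InnerProductSpace ℝ X]
    (S : X →L[ℝ] Y) {N : Set (Y →L[ℝ] ℝ)} (hN : IsNormingSet N)
    {Lam : Set (X →L[ℝ] ℝ)} (hLam : ∀ l ∈ N, l.comp S ∈ Lam) {n : ℕ} (hn : 1 ≤ n) :
    (∏ k ∈ Finset.range (2 * n), minErrDetNon S (Metric.closedBall 0 1) Lam k) ^ (1 / (2 * n : ℝ)) ≤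
      ENNReal.ofReal (25 / 6 * √(2 * n)) *
        (∏ k ∈ Finset.range n, minErrRan.{u, v, w} S (Metric.closedBall 0 1) k) ^ (1 / (n : ℝ)) := by
  refine ENNReal.geom_mean_le_of_le hn ?_
  rw [← one_mul (∏ k ∈ Finset.range (2 * n), minErrDetNon S _ Lam k)]
  refine ENNReal.mul_prod_le_of_forall_lt fun a ha => ?_
  obtain ⟨f, g, l, hf, hg, hl, htri, hlt⟩ := exists_triangular_of_lt_minErrDetNon S hN hLam _ ha
  -- Halving puts the differences in the unit ball; this doubles `25/12` to `25/6`, but gives `r =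
  -- 1`.
  let h : Fin (2 * n) → X := fun k => (1 / 2 : ℝ) • (f k - g k)
  have hψh : ∀ i k, ((l i).comp S) (h k) = 1 / 2 * l i (S (f k - g k)) := fun i k => by
    simp [h]
  have hh : ∀ k, ‖h k‖ ≤ 1 := fun k => by
    have h1 := mem_closedBall_zero_iff.1 (hf k)
    have h2 := mem_closedBall_zero_iff.1 (hg k)
    have h3 := norm_sub_le (f k) (g k)
    simp only [h]
    rw [norm_smul, Real.norm_of_nonneg (by norm_num)]
    linarith
  obtain ⟨q, hq, hqtri, hqd⟩ := exists_orthonormal_triangular h hh (fun i => (l i).comp S)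
    (fun i k hik => by rw [hψh, htri i k hik, mul_zero]) (fun k h0 => by
      rw [hψh] at h0
      have h1 : l k (S (f k - g k)) = 0 := by linarith
      have h2 := hlt k
      rw [h1, enorm_zero] at h2
      exact not_lt_bot h2)
  have h1 := prod_le_prod_minErrRan.{u, v, w} S (convex_closedBall (0 : X) 1) n q l
    (fun i => hN.abs_le (hl i)) hqtri 0 one_pos fun x hx => by
      rw [one_smul, zero_add, mem_closedBall_zero_iff]
      exact hq.norm_sum_smul_le_one hx
  have hhalf : (2 : ℝ≥0∞) * ‖(1 / 2 : ℝ)‖ₑ = 1 := by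
    rw [Real.enorm_eq_ofReal (by norm_num : (0 : ℝ) ≤ 1 / 2), ← ENNReal.ofReal_ofNat,
      ← ENNReal.ofReal_mul (by norm_num)]
    norm_num
  have hpow : (2 : ℝ≥0∞) ^ (2 * n) = (2 ^ n) ^ 2 := by rw [mul_comm, pow_mul]
  have h2 : ∀ k : Fin (2 * n), a k ≤ 2 * ‖l k (S (q k))‖ₑ := fun k => by
    refine (hlt k).le.trans ?_
    have h3 := hqd k
    rw [hψh, enorm_mul] at h3
    calc ‖l k (S (f k - g k))‖ₑ = 2 * (‖(1 / 2 : ℝ)‖ₑ * ‖l k (S (f k - g k))‖ₑ) := by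
          rw [← mul_assoc, hhalf, one_mul]
      _ ≤ _ := by gcongr; exact h3
  rw [one_mul, ← Fin.prod_univ_eq_prod_range]
  refine (Finset.prod_le_prod' fun k _ => h2 k).trans ?_
  rw [Finset.prod_mul_distrib, Finset.prod_const, Finset.card_univ, Fintype.card_fin, hpow]
  refine (mul_le_mul_right h1 _).trans (le_of_eq ?_)
  rw [← mul_pow, ← mul_assoc, ← mul_pow, ← ENNReal.ofReal_ofNat, ← ENNReal.ofReal_mul (by norm_num),
    show (2 : ℝ) * (25 / 12 * √(2 * n) / 1) = 25 / 6 * √(2 * n) by ring]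

end MainInequalities

/-- The bound `36/25` for `√2` is chosen so that `25/3 * (36/25) = 12` in the general case. -/
theorem Real.sqrt_two_mul_le (n : ℕ) : √(2 * n) ≤ 36 / 25 * √n := by
  rw [Real.sqrt_mul (by norm_num)]
  refine mul_le_mul_of_nonneg_right ?_ (Real.sqrt_nonneg _)
  rw [Real.sqrt_le_left (by norm_num)]
  norm_num

theorem mainTheorem4 {X : Type u} {Y : Type v}
    [NormedAddCommGroup X] [instX : NormedSpace ℝ X] [CompleteSpace X]
    [NormedAddCommGroup Y] [NormedSpace ℝ Y] [CompleteSpace Y]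
    (S : X →L[ℝ] Y) (N : Set (Y →L[ℝ] ℝ)) (hN : IsNormingSet N)
    (Lam : Set (X →L[ℝ] ℝ)) (hLam : ∀ l ∈ N, l.comp S ∈ Lam)
    (F : Set X) (hF : Convex ℝ F) (n : ℕ) (hn : 1 ≤ n) :
    -- general case
    (minErrDetNon S F Lam (2 * n - 1) ≤
        (∏ k ∈ Finset.range (2 * n), minErrDetNon S F Lam k) ^ (1 / (2 * n : ℝ)) ∧
      (∏ k ∈ Finset.range (2 * n), minErrDetNon S F Lam k) ^ (1 / (2 * n : ℝ)) ≤
        12 * (n : ℝ≥0∞) ^ (3 / 2 : ℝ) *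
          (∏ k ∈ Finset.range n, minErrRan.{u, v, w} S F k) ^ (1 / (n : ℝ))) ∧
    -- symmetric input sets
    ((∀ x ∈ F, -x ∈ F) →
      (∏ k ∈ Finset.range (2 * n), minErrDetNon S F Lam k) ^ (1 / (2 * n : ℝ)) ≤
        12 * (n : ℝ≥0∞) *
          (∏ k ∈ Finset.range n, minErrRan.{u, v, w} S F k) ^ (1 / (n : ℝ))) ∧
    -- the norm of `X` comes from an inner product and `F` is the closed unit ball of `X`
    ((∃ I : InnerProductSpace ℝ X, I.toNormedSpace = instX) → F = Metric.closedBall (0 : X) 1 →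
      minErrDetNon S F Lam (4 * n - 1) ≤
        (∏ k ∈ Finset.range (4 * n), minErrDetNon S F Lam k) ^ (1 / (4 * n : ℝ)) ∧
      (∏ k ∈ Finset.range (4 * n), minErrDetNon S F Lam k) ^ (1 / (4 * n : ℝ)) ≤
        12 * (n : ℝ≥0∞) ^ (1 / 2 : ℝ) *
          (∏ k ∈ Finset.range n, minErrRan.{u, v, w} S F k) ^ (1 / (n : ℝ))) := by
  have hn' : (0 : ℝ) < n := by exact_mod_cast hn
  have hm : 0 < 2 * n := by omega
  have hanti : Antitone (minErrDetNon S F Lam) :=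
    minErrDetNon_antitone S F (hN.nonempty.elim fun l hl => ⟨_, hLam l hl⟩)
  refine ⟨⟨hanti.le_geom_mean hm (by push_cast; rfl), ?_⟩, fun hsymm => ?_, ?_⟩
  · refine (geom_mean_minErrDetNon_le.{u, v, w} S hN hLam hF hn
      (r := 1 / (2 * (2 * n : ℕ) : ℝ)) (by positivity) fun f g hf hg => ⟨_, fun x hx =>
        hF.midpoint_add_sum_sub_mem hm hf hg (abs_le_one_of_sum_sq_le_one hx)⟩).trans ?_
    gcongr
    refine ENNReal.ofReal_le_ofNat_mul_natCast_rpow hn ?_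
    have h1 : (n : ℝ) ^ (3 / 2 : ℝ) = n * √n := by
      rw [show (3 / 2 : ℝ) = 1 + 1 / 2 by norm_num, Real.rpow_add hn', Real.rpow_one,
        ← Real.sqrt_eq_rpow]
    rw [h1]
    calc 25 / 12 * √(2 * n) / (1 / (2 * (2 * n : ℕ) : ℝ)) = 25 / 3 * n * √(2 * n) := by
          push_cast; field_simp; ring
      _ ≤ 25 / 3 * n * (36 / 25 * √n) := by gcongr; exact Real.sqrt_two_mul_le n
      _ = _ := by ring
  · refine (geom_mean_minErrDetNon_le.{u, v, w} S hN hLam hF hn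
      (r := 1 / (2 * √(2 * n : ℕ))) (by positivity) fun f g hf hg => ⟨0, fun x hx => by
        rw [zero_add]
        exact hF.sum_sub_mem_of_symmetric hsymm hm hf hg hx⟩).trans ?_
    gcongr
    rw [← ENNReal.rpow_one (n : ℝ≥0∞)]
    refine ENNReal.ofReal_le_ofNat_mul_natCast_rpow hn ?_
    rw [Real.rpow_one]
    have h1 : √(2 * n : ℝ) * √(2 * n : ℝ) = 2 * n := Real.mul_self_sqrt (by positivity)
    calc 25 / 12 * √(2 * n) / (1 / (2 * √(2 * n : ℕ)))
        = 25 / 6 * (√(2 * n : ℝ) * √(2 * n : ℝ)) := by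
          push_cast; field_simp; ring
      _ ≤ 12 * n := by rw [h1]; linarith
  · rintro ⟨I, rfl⟩ rfl
    refine ⟨hanti.le_geom_mean (by omega) (by push_cast; rfl), ?_⟩
    -- The Hilbert bound already holds for `2n` factors; monotonicity of the errors extends it to
    -- `4n`.
    have h1 := hanti.geom_mean_two_mul_le (m := 2 * n) (r := 2 * n) (by positivity)
    rw [← mul_assoc, ← mul_assoc, show (2 : ℝ) * 2 = 4 by norm_num] at h1
    refine h1.trans ((geom_mean_minErrDetNon_closedBall_le.{u, v, w} S hN hLam hn).trans ?_)
    gcongr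
    refine ENNReal.ofReal_le_ofNat_mul_natCast_rpow hn ?_
    rw [← Real.sqrt_eq_rpow]
    have h2 := Real.sqrt_two_mul_le n
    have h3 := Real.sqrt_nonneg (n : ℝ)
    linarith
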